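/- Let $G$ be a connected threshold graph on a finite node set $V$ with $n=|V|>1$, where threshold graphs are the graphs obtained from a single node by repeatedly adding one node that is adjacent either to none or to all of the previous nodes. Let $\{\mathcal C_1,\dots,\mathcal C_p\}$ be its degree partition, i.e. the partition of $V$ into nonempty cells such that two nodes lie in the same cell if and only if they have the same degree, and let $m_i=|\mathcal C_i|$. For nodes $j_1,\dots,j_m\in V$ ($m\ge 0$), consider the linear system $$\dot x=-L(G)\,x+Bu,\qquad B=[e_{j_1},\dots,e_{j_m}],$$ where $L(G)$ is the Laplacian matrix of $G$ and $e_j$ are the standard basis vectors, and call $V_C=\{j_1,\dots,j_m\}$ the set of control nodes. The system is controllable if every state in $\mathbb R^V$ can be steered to every other state in some finite time by a measurable, essentially bounded input $u$. Then the minimum cardinality of a set $V_C$ of control nodes from which the system is controllable is $n-p$. Moreover, a set $V_C$ of control nodes with $|V_C|=n-p$ renders the system controllable if and only if $|V_C\cap\mathcal C_i|=m_i-1$ for every $1\le i\le p$. -/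

import Mathlib

universe u

open MeasureTheory Matrix

/-- Threshold graphs: a graph on a single node is a threshold graph, and a graph is a threshold
graph when it is obtained from a threshold graph (on the vertices other than `v`) by adding
one node `v`, either through the union operation (`v` is joined to no old node) or through the join
operation (`v` is joined to every old node). -/
inductive IsThreshold : {V : Type u} → SimpleGraph V → Prop
  | single {V : Type u} [Unique V] (G : SimpleGraph V) : IsThreshold G
  | union {V : Type u} (G : SimpleGraph V) (v : V)
      (hv : ∀ w, ¬ G.Adj v w) (hG : IsThreshold (G.induce {v}ᶜ)) : IsThreshold G
  | join {V : Type u} (G : SimpleGraph V) (v : V)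
      (hv : ∀ w, w ≠ v → G.Adj v w) (hG : IsThreshold (G.induce {v}ᶜ)) : IsThreshold G

/-- `x` is a solution on `[0, T]` of the linear time-invariant system `ẋ = A x + B u` with
input `u`, in the integrated (Carathéodory) sense, which makes sense for discontinuous inputs. -/
def IsTrajectory {V ι : Type*} [Fintype V] [Fintype ι] (A : Matrix V V ℝ) (B : Matrix V ι ℝ)
    (T : ℝ) (u : ℝ → ι → ℝ) (x : ℝ → V → ℝ) : Prop :=
  ContinuousOn x (Set.Icc 0 T) ∧
    ∀ t ∈ Set.Icc (0 : ℝ) T, x t = x 0 + ∫ s in (0 : ℝ)..t, (A *ᵥ x s + B *ᵥ u s)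

/-- Controllability of `ẋ = A x + B u`: every state can be steered to every state in some finite
time by a measurable, essentially bounded input. -/
def IsControllable {V ι : Type*} [Fintype V] [Fintype ι] (A : Matrix V V ℝ) (B : Matrix V ι ℝ) :
    Prop :=
  ∀ x₀ x₁ : V → ℝ, ∃ T : ℝ, 0 < T ∧ ∃ (u : ℝ → ι → ℝ) (x : ℝ → V → ℝ),
    MemLp u ⊤ (volume.restrict (Set.Icc 0 T)) ∧ IsTrajectory A B T u x ∧ x 0 = x₀ ∧ x T = x₁

/-- The input matrix `B = [e_{j 1}, …, e_{j m}]`, whose columns are standard basis vectors. -/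
def inputMatrix {V : Type*} [DecidableEq V] {m : ℕ} (j : Fin m → V) : Matrix V (Fin m) ℝ :=
  Matrix.of fun v k => if v = j k then 1 else 0

/-- The set of control nodes `{j 1, …, j m}`. -/
def controlNodes {V : Type*} [DecidableEq V] {m : ℕ} (j : Fin m → V) : Finset V :=
  Finset.univ.image j

/-- The Laplacian network `ẋ = -L(G) x + B u` with `B = [e_{j 1}, …, e_{j m}]` is controllable. -/
def LaplacianControllable {V : Type*} [Fintype V] [DecidableEq V] (G : SimpleGraph V)
    [DecidableRel G.Adj] {m : ℕ} (j : Fin m → V) : Prop :=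
  IsControllable (-(G.lapMatrix ℝ)) (inputMatrix j)

/-- The partition of the node set into the nonempty classes of nodes of equal degree. -/
def degreePartition {V : Type*} [Fintype V] [DecidableEq V] (G : SimpleGraph V)
    [DecidableRel G.Adj] : Finpartition (Finset.univ : Finset V) :=
  letI : DecidableRel (Setoid.ker fun v => G.degree v).r :=
    fun v w => inferInstanceAs (Decidable (G.degree v = G.degree w))
  Finpartition.ofSetoid (Setoid.ker fun v => G.degree v)

/-- Two nodes lie in a common cell of the degree partition exactly when their degrees agree. -/
theorem degree_eq_iff_exists_mem_degreePartition {V : Type*} [Fintype V] [DecidableEq V]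
    (G : SimpleGraph V) [DecidableRel G.Adj] (v w : V) :
    G.degree v = G.degree w ↔ ∃ C ∈ (degreePartition G).parts, v ∈ C ∧ w ∈ C := by
  let _ : DecidableRel (Setoid.ker fun v => G.degree v).r :=
    fun v w => inferInstanceAs (Decidable (G.degree v = G.degree w))
  have key : w ∈ (degreePartition G).part v ↔ G.degree v = G.degree w :=
    Finpartition.mem_part_ofSetoid_iff_rel
  rw [← key, Finpartition.mem_part_iff_exists]
  simp only [and_comm]

/-!
For a symmetric matrix `A`, the system `ẋ = A x + B u` is controllable exactly when no eigenvector
of `A` is orthogonal to the columns of `B` (`isControllable_iff_of_isSymm`). Such an eigenvector `q`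
makes `q ⬝ᵥ x` satisfy an autonomous linear equation. Conversely, a covector annihilating all
`∫₀¹ exp (-s A) B u(s) ds` annihilates `exp (-s A) B` for `s ∈ [0, 1]`; the space of these covectors
is invariant under `A`, so that it contains an eigenvector unless it is trivial.

For the Laplacian network the question is therefore which sets of nodes meet the support of every
Laplacian eigenvector. In a connected threshold graph these are the sets whose complement contains
no two nodes of equal degree (`laplacianControllable_iff_injOn_degree`):

* Two nodes `a`, `b` of equal degree are twins (`IsThreshold.adj_iff_of_degree_eq`), so `e_a - e_b`
  is an eigenvector.
* An eigenvector `x` orthogonal to the constants and supported on nodes of distinct degrees is zero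
  (`IsThreshold.eq_zero_of_lapMatrix_mulVec_eq_smul`). This goes by induction along the construction
  of the graph. If the last node `v` is isolated, then `μ * x v = 0`. Either `x v = 0`, and `v` can
  be removed, or `x` lies in the kernel. A kernel vector is constant along edges; it vanishes off
  the isolated nodes, because a threshold graph with an edge has two nodes of equal degree joined
  by a path (`IsThreshold.eq_zero_of_forall_adj_eq`), and at most one isolated node remains. If `v`
  is dominating, then `(n - μ) * x v = 0`. Either `v` can be removed again, or `x` lies in the
  kernel of the Laplacian of the complement, which is again a threshold graph and whose Laplacian
  is `n - L` on vectors orthogonal to the constants.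

It remains to count: the complement of the control set may contain at most one node of each of
the `p` cells.
-/

/-! ### The Hautus test for symmetric systems -/

/-- A left eigenvector of `A` that annihilates `B` obstructs controllability: along a trajectory
`x`, the function `q ⬝ᵥ x` solves `ẏ = μ y` whatever the input, so it cannot leave `0`. -/
theorem IsControllable.eq_zero_of_vecMul_eq_zero {V ι : Type*} [Fintype V] [Fintype ι]
    {A : Matrix V V ℝ} {B : Matrix V ι ℝ} (h : IsControllable A B) {q : V → ℝ} {μ : ℝ}
    (hA : q ᵥ* A = μ • q) (hB : q ᵥ* B = 0) : q = 0 := by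
  obtain ⟨T, hT, u, x, hu, ⟨hx, hsol⟩, hx0, hxT⟩ := h 0 q
  set y : ℝ → ℝ := fun t => q ⬝ᵥ x t with hy
  have hycont : ContinuousOn y (Set.Icc 0 T) := by
    have : Continuous fun v : V → ℝ => q ⬝ᵥ v := by fun_prop
    exact this.comp_continuousOn hx
  have hint : ∀ t ∈ Set.Icc (0 : ℝ) T,
      IntervalIntegrable (fun s => A *ᵥ x s + B *ᵥ u s) volume 0 t := by
    intro t ht
    have hsub : Set.uIcc 0 t ⊆ Set.Icc 0 T := by
      rw [Set.uIcc_of_le ht.1]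
      exact Set.Icc_subset_Icc_right ht.2
    have hc : Continuous fun v : V → ℝ => A *ᵥ v := by fun_prop
    refine ((hc.comp_continuousOn hx).mono hsub).intervalIntegrable.add ?_
    have hui : IntegrableOn u (Set.Icc 0 T) volume := hu.integrable le_top
    have h2 := (Matrix.mulVecLin B).toContinuousLinearMap.integrable_comp hui
    refine IntegrableOn.intervalIntegrable (IntegrableOn.mono_set ?_ hsub)
    exact h2
  have hyeq : ∀ t ∈ Set.Icc (0 : ℝ) T, y t = ∫ s in (0 : ℝ)..t, μ * y s := by
    intro t ht
    let ℓ : (V → ℝ) →L[ℝ] ℝ := (dotProductBilin ℝ ℝ q).toContinuousLinearMap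
    have hℓ : ∀ v, ℓ v = q ⬝ᵥ v := fun v => rfl
    have h1 := ℓ.intervalIntegral_comp_comm (hint t ht)
    have h2 : y t = ℓ (∫ s in (0 : ℝ)..t, A *ᵥ x s + B *ᵥ u s) := by
      simp only [hy]
      rw [hsol t ht, hx0, zero_add, hℓ]
    rw [h2, ← h1]
    congr 1
    ext s
    rw [hℓ, dotProduct_add, dotProduct_mulVec, dotProduct_mulVec, hA, hB]
    simp [hy]
  -- `y` is only controlled on `[0, T]`, so it is extended before differentiating its integral.
  let g : ℝ → ℝ := Set.IccExtend hT.le ((Set.Icc 0 T).domRestrict y)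
  have hg : Continuous g := hycont.domRestrict.Icc_extend'
  have hgy : ∀ t ∈ Set.Icc (0 : ℝ) T, g t = y t := fun t ht => by
    simp only [g]
    rw [Set.IccExtend_of_mem _ _ ht]
    rfl
  let F : ℝ → ℝ := fun t => ∫ s in (0 : ℝ)..t, μ * g s
  have hF : ∀ t, HasDerivAt F (μ * g t) t := fun t =>
    intervalIntegral.integral_hasDerivAt_right
      ((continuous_const.mul hg).intervalIntegrable _ _)
      ((continuous_const.mul hg).stronglyMeasurableAtFilter _ _)
      (continuous_const.mul hg).continuousAt
  have hFy : ∀ t ∈ Set.Icc (0 : ℝ) T, F t = y t := by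
    intro t ht
    rw [hyeq t ht]
    refine intervalIntegral.integral_congr fun s hs => ?_
    rw [Set.uIcc_of_le ht.1] at hs
    rw [hgy s ⟨hs.1, hs.2.trans ht.2⟩]
  have hzero := eq_zero_of_abs_deriv_le_mul_abs_self_of_eq_zero_right (f := F) (K := |μ|)
    (fun t _ => (hF t).continuousAt.continuousWithinAt)
    (fun t _ => (hF t).hasDerivWithinAt) (by simp [F])
    (fun t ht => by
      have ht' : t ∈ Set.Icc (0 : ℝ) T := ⟨ht.1, ht.2.le⟩
      rw [hgy t ht', hFy t ht', norm_mul, Real.norm_eq_abs]) T ⟨hT.le, le_rfl⟩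
  rw [hFy T ⟨hT.le, le_rfl⟩] at hzero
  simp only [hy, hxT] at hzero
  exact dotProduct_self_eq_zero.mp hzero

/-- Variation of constants: a continuous input steers `x₀` to
`exp (T A) (x₀ + ∫₀ᵀ exp (-s A) B u(s) ds)`. -/
theorem exists_isTrajectory_of_continuous {V ι : Type*} [Fintype V] [Fintype ι]
    (A : Matrix V V ℝ) (B : Matrix V ι ℝ) (T : ℝ) {u : ℝ → ι → ℝ} (hu : Continuous u)
    (x₀ : V → ℝ) : ∃ x, IsTrajectory A B T u x ∧ x 0 = x₀ ∧
      x T = NormedSpace.exp (T • A.mulVecLin.toContinuousLinearMap)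
        (x₀ + ∫ s in (0 : ℝ)..T,
          NormedSpace.exp ((-s) • A.mulVecLin.toContinuousLinearMap) (B *ᵥ u s)) := by
  set A' := A.mulVecLin.toContinuousLinearMap with hA'
  let E : ℝ → (V → ℝ) →L[ℝ] (V → ℝ) := fun t => NormedSpace.exp (t • A')
  have hE : ∀ t, HasDerivAt E (A' * E t) t := fun t => hasDerivAt_exp_smul_const' A' t
  have hEcont : Continuous E := continuous_iff_continuousAt.2 fun t => (hE t).continuousAt
  have hf : Continuous fun s => E (-s) (B *ᵥ u s) :=
    (hEcont.comp continuous_neg).clm_apply (by fun_prop)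
  let z : ℝ → V → ℝ := fun t => x₀ + ∫ s in (0 : ℝ)..t, E (-s) (B *ᵥ u s)
  have hz : ∀ t, HasDerivAt z (E (-t) (B *ᵥ u t)) t := fun t =>
    (intervalIntegral.integral_hasDerivAt_right (hf.intervalIntegrable _ _)
      (hf.stronglyMeasurableAtFilter _ _) hf.continuousAt).const_add x₀
  have hEE : ∀ t v, E t (E (-t) v) = v := by
    intro t v
    have h1 : E t * E (-t) = 1 := by
      let _ : NormedAlgebra ℚ ((V → ℝ) →L[ℝ] (V → ℝ)) := NormedAlgebra.restrictScalars ℚ ℝ _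
      simp only [E]
      rw [← NormedSpace.exp_add_of_commute ((Commute.refl A').smul_left _ |>.smul_right _),
        ← add_smul]
      simp
    exact congrArg (fun L : (V → ℝ) →L[ℝ] (V → ℝ) => L v) h1
  have hx : ∀ t, HasDerivAt (fun t => E t (z t)) (A *ᵥ E t (z t) + B *ᵥ u t) t := by
    intro t
    have h1 := (hE t).clm_apply (hz t)
    rw [hEE] at h1
    exact h1
  have hxc : Continuous fun t => E t (z t) :=
    continuous_iff_continuousAt.2 fun t => (hx t).continuousAt
  refine ⟨fun t => E t (z t), ⟨hxc.continuousOn, fun t _ => ?_⟩, ?_, rfl⟩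
  · rw [intervalIntegral.integral_eq_sub_of_hasDerivAt (fun s _ => hx s)
      (Continuous.intervalIntegrable (by fun_prop) _ _)]
    simp
  · simp [E, z]

/-- The states `∫₀¹ exp (-s A) B u(s) ds`, with `u` continuous; the time-one flow maps this
subspace onto the set of states reachable from `0` by continuous inputs. -/
def pulledBackReachable {V ι : Type*} [Fintype V] [Fintype ι] (A : Matrix V V ℝ)
    (B : Matrix V ι ℝ) : Submodule ℝ (V → ℝ) where
  carrier := {r | ∃ u : ℝ → ι → ℝ, Continuous u ∧ r = ∫ s in (0 : ℝ)..1,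
    NormedSpace.exp ((-s) • A.mulVecLin.toContinuousLinearMap) (B *ᵥ u s)}
  zero_mem' := ⟨0, continuous_zero, by simp⟩
  add_mem' := by
    rintro _ _ ⟨u, hu, rfl⟩ ⟨v, hv, rfl⟩
    refine ⟨u + v, hu.add hv, ?_⟩
    have hE : Continuous fun s : ℝ =>
        NormedSpace.exp ((-s) • A.mulVecLin.toContinuousLinearMap) :=
      (continuous_iff_continuousAt.2 fun t =>
        (hasDerivAt_exp_smul_const' A.mulVecLin.toContinuousLinearMap t).continuousAt).comp
        continuous_neg
    rw [← intervalIntegral.integral_add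
      ((hE.clm_apply (by fun_prop)).intervalIntegrable _ _)
      ((hE.clm_apply (by fun_prop)).intervalIntegrable _ _)]
    simp [mulVec_add]
  smul_mem' := by
    rintro c _ ⟨u, hu, rfl⟩
    refine ⟨c • u, hu.const_smul c, ?_⟩
    rw [← intervalIntegral.integral_smul]
    simp [mulVec_smul]

/-- The covectors that annihilate `exp (-s A) B` for all `s ∈ [0, 1]`, taken in the Euclidean space
so that the theory of symmetric operators applies; this is the kernel of the Gramian
`∫₀¹ exp (-s A) B Bᵀ exp (-s Aᵀ) ds`. -/
def gramianKernel {V ι : Type*} [Fintype V] [Fintype ι] (A : Matrix V V ℝ)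
    (B : Matrix V ι ℝ) : Submodule ℝ (EuclideanSpace ℝ V) where
  carrier := {q | ∀ s ∈ Set.Icc (0 : ℝ) 1, ∀ w : ι → ℝ, q.ofLp ⬝ᵥ
    NormedSpace.exp ((-s) • A.mulVecLin.toContinuousLinearMap) (B *ᵥ w) = 0}
  zero_mem' := by simp
  add_mem' := fun hp hq s hs w => by
    rw [WithLp.ofLp_add, add_dotProduct, hp s hs w, hq s hs w, add_zero]
  smul_mem' := fun c q hq s hs w => by
    rw [WithLp.ofLp_smul, smul_dotProduct, hq s hs w, smul_zero]

/-- Differentiating `q ⬝ᵥ exp (-s A) B w = 0` in `s` moves one factor `A` onto `q`. -/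
theorem toEuclideanLin_mem_gramianKernel {V ι : Type*} [Fintype V] [DecidableEq V] [Fintype ι]
    {A : Matrix V V ℝ} (hA : A.IsSymm) (B : Matrix V ι ℝ) :
    ∀ q ∈ gramianKernel A B, A.toEuclideanLin q ∈ gramianKernel A B := by
  intro q hq s hs w
  set A' := A.mulVecLin.toContinuousLinearMap with hA'
  have hd : HasDerivAt (fun s : ℝ => NormedSpace.exp ((-s) • A') (B *ᵥ w))
      (-(A' (NormedSpace.exp ((-s) • A') (B *ᵥ w)))) s := by
    have h1 := ((hasDerivAt_exp_smul_const' A' (-s)).scomp s (hasDerivAt_neg s)).clm_apply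
      (hasDerivAt_const s (B *ᵥ w))
    rw [ContinuousLinearMap.map_zero, add_zero, neg_one_smul] at h1
    exact h1
  let ℓ : (V → ℝ) →L[ℝ] ℝ := (dotProductBilin ℝ ℝ q.ofLp).toContinuousLinearMap
  have h2 : HasDerivWithinAt (fun s : ℝ => q.ofLp ⬝ᵥ NormedSpace.exp ((-s) • A') (B *ᵥ w))
      (q.ofLp ⬝ᵥ (-(A' (NormedSpace.exp ((-s) • A') (B *ᵥ w))))) (Set.Icc 0 1) s :=
    (ℓ.hasFDerivAt.comp_hasDerivAt s hd).hasDerivWithinAt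
  have h3 : HasDerivWithinAt (fun s : ℝ => q.ofLp ⬝ᵥ NormedSpace.exp ((-s) • A') (B *ᵥ w))
      0 (Set.Icc 0 1) s :=
    (hasDerivWithinAt_const s (Set.Icc (0 : ℝ) 1) (0 : ℝ)).congr
      (fun t ht => hq t ht w) (hq s hs w)
  have h4 := (uniqueDiffOn_Icc (zero_lt_one' ℝ) s hs).eq_deriv _ h2 h3
  have h5 : A' (NormedSpace.exp ((-s) • A') (B *ᵥ w))
      = A *ᵥ (NormedSpace.exp ((-s) • A') (B *ᵥ w)) := rfl
  rw [dotProduct_neg, neg_eq_zero, h5, dotProduct_mulVec, ← mulVec_transpose, hA.eq] at h4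
  exact h4

/-- If no eigenvector of the symmetric matrix `A` annihilates `B`, the kernel is trivial, since
`A` would have an eigenvector in it. -/
theorem gramianKernel_eq_bot {V ι : Type*} [Fintype V] [DecidableEq V] [Fintype ι]
    {A : Matrix V V ℝ} {B : Matrix V ι ℝ} (hA : A.IsSymm)
    (h : ∀ (q : V → ℝ) (μ : ℝ), A *ᵥ q = μ • q → q ᵥ* B = 0 → q = 0) :
    gramianKernel A B = ⊥ := by
  have hinv := toEuclideanLin_mem_gramianKernel hA B
  have hsym : A.toEuclideanLin.IsSymmetric :=
    Matrix.isSymmetric_toEuclideanLin_iff.2 (by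
      rw [IsHermitian, conjTranspose_eq_transpose_of_trivial]
      exact hA)
  rw [← Submodule.subsingleton_iff_eq_bot]
  refine (hsym.restrict_invariant hinv).subsingleton_of_no_eigenvalue_finiteDimensional
    fun μ => ?_
  rw [Submodule.eq_bot_iff]
  rintro ⟨q, hq⟩ hμ
  rw [Module.End.mem_eigenspace_iff] at hμ
  have h1 : A *ᵥ q.ofLp = μ • q.ofLp := by
    have := congrArg (fun v : gramianKernel A B => (v : EuclideanSpace ℝ V).ofLp) hμ
    simpa using this
  have h2 : q.ofLp ᵥ* B = 0 := by
    rw [← dotProduct_self_eq_zero, ← dotProduct_mulVec]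
    simpa using hq 0 ⟨le_rfl, zero_le_one⟩ (q.ofLp ᵥ* B)
  have h3 := h _ _ h1 h2
  ext v
  exact congrFun h3 v

theorem LinearMap.apply_eq_dotProduct_single {ι R : Type*} [Fintype ι] [DecidableEq ι]
    [CommSemiring R] (f : (ι → R) →ₗ[R] R) (x : ι → R) :
    f x = (fun i => f (Pi.single i 1)) ⬝ᵥ x := by
  conv_lhs => rw [← Finset.univ_sum_single x]
  rw [map_sum]
  refine Finset.sum_congr rfl fun i _ => ?_
  rw [mul_comm, ← smul_eq_mul, ← map_smul, ← Pi.single_smul, smul_eq_mul, mul_one]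

/-- A functional that vanishes on the pulled-back reachable states lies in the kernel of the
Gramian. -/
theorem pulledBackReachable_eq_top {V ι : Type*} [Fintype V] [Fintype ι]
    {A : Matrix V V ℝ} {B : Matrix V ι ℝ} (h : gramianKernel A B = ⊥) :
    pulledBackReachable A B = ⊤ := by
  classical
  by_contra hne
  obtain ⟨f, hf0, hf⟩ := Submodule.exists_le_ker_of_lt_top _ (lt_top_iff_ne_top.2 hne)
  set A' := A.mulVecLin.toContinuousLinearMap with hA'
  set q : V → ℝ := fun v => f (Pi.single v 1) with hq
  have hfq : ∀ x, f x = q ⬝ᵥ x := f.apply_eq_dotProduct_single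
  let f' : (V → ℝ) →L[ℝ] ℝ := f.toContinuousLinearMap
  have hE : Continuous fun s : ℝ => NormedSpace.exp ((-s) • A') :=
    (continuous_iff_continuousAt.2 fun t =>
      (hasDerivAt_exp_smul_const' A' t).continuousAt).comp continuous_neg
  -- The input `u(s) = (exp (-s A) B)ᵀ q` turns the pairing with `q` into an integral of squares.
  let u : ℝ → ι → ℝ := fun s k => q ⬝ᵥ NormedSpace.exp ((-s) • A') (B *ᵥ Pi.single k 1)
  have hu_pair : ∀ s w, q ⬝ᵥ NormedSpace.exp ((-s) • A') (B *ᵥ w) = u s ⬝ᵥ w := by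
    intro s w
    let g : (ι → ℝ) →ₗ[ℝ] ℝ := dotProductBilin ℝ ℝ q ∘ₗ
      (NormedSpace.exp ((-s) • A')).toLinearMap ∘ₗ B.mulVecLin
    exact g.apply_eq_dotProduct_single w
  have hu : Continuous u := continuous_pi fun k =>
    continuous_const.dotProduct (hE.clm_apply continuous_const)
  have hcont : Continuous fun s => u s ⬝ᵥ u s := by fun_prop
  have hint : ∫ s in (0 : ℝ)..1, u s ⬝ᵥ u s = 0 := by
    have h1 : f (∫ s in (0 : ℝ)..1, NormedSpace.exp ((-s) • A') (B *ᵥ u s)) = 0 :=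
      hf ⟨u, hu, rfl⟩
    have h2 := f'.intervalIntegral_comp_comm (μ := volume) (a := 0) (b := 1)
      (f := fun s => NormedSpace.exp ((-s) • A') (B *ᵥ u s))
      ((hE.clm_apply (by fun_prop)).intervalIntegrable _ _)
    have h3 : ∀ s, f' (NormedSpace.exp ((-s) • A') (B *ᵥ u s)) = u s ⬝ᵥ u s := fun s => by
      rw [← hu_pair]; exact hfq _
    simp only [h3] at h2
    rw [h2]
    exact h1
  have hu0 : ∀ s ∈ Set.Icc (0 : ℝ) 1, u s = 0 := by
    intro s hs
    by_contra hne
    have hpos := intervalIntegral.integral_pos (zero_lt_one' ℝ) hcont.continuousOn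
      (fun t _ => Finset.sum_nonneg fun i _ => mul_self_nonneg _)
      ⟨s, hs, lt_of_le_of_ne (Finset.sum_nonneg fun i _ => mul_self_nonneg _)
        (Ne.symm (dotProduct_self_eq_zero.not.2 hne))⟩
    exact hpos.ne' hint
  have hmem : WithLp.toLp 2 q ∈ gramianKernel A B := by
    intro s hs w
    have := hu_pair s w
    rw [hu0 s hs, zero_dotProduct] at this
    exact this
  rw [h, Submodule.mem_bot] at hmem
  refine hf0 (LinearMap.ext fun x => ?_)
  have hq0 : q = 0 := congrArg WithLp.ofLp hmem
  rw [hfq, hq0, zero_dotProduct, LinearMap.zero_apply]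

/-- The Hautus test for a symmetric state matrix. -/
theorem isControllable_iff_of_isSymm {V ι : Type*} [Fintype V] [Fintype ι]
    {A : Matrix V V ℝ} (hA : A.IsSymm) (B : Matrix V ι ℝ) :
    IsControllable A B ↔
      ∀ (q : V → ℝ) (μ : ℝ), A *ᵥ q = μ • q → q ᵥ* B = 0 → q = 0 := by
  classical
  constructor
  · intro h q μ hq hB
    refine h.eq_zero_of_vecMul_eq_zero (μ := μ) ?_ hB
    rw [← mulVec_transpose, hA.eq, hq]
  · intro h x₀ x₁
    set A' := A.mulVecLin.toContinuousLinearMap with hA'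
    have htop := pulledBackReachable_eq_top (gramianKernel_eq_bot hA h)
    have hmem : NormedSpace.exp (-A') x₁ - x₀ ∈ pulledBackReachable A B := by
      rw [htop]; trivial
    obtain ⟨u, hu, hr⟩ := hmem
    obtain ⟨x, hx, hx0, hx1⟩ := exists_isTrajectory_of_continuous A B 1 hu x₀
    refine ⟨1, one_pos, u, x, ?_, hx, hx0, ?_⟩
    · obtain ⟨C, hC⟩ := (isCompact_Icc (a := (0 : ℝ)) (b := 1)).exists_bound_of_continuousOn
        hu.continuousOn
      exact MemLp.of_bound hu.aestronglyMeasurable C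
        ((ae_restrict_iff' measurableSet_Icc).2 (ae_of_all _ hC))
    · rw [hx1, ← hr, add_sub_cancel, one_smul]
      have h1 : NormedSpace.exp A' * NormedSpace.exp (-A') = 1 := by
        let _ : NormedAlgebra ℚ ((V → ℝ) →L[ℝ] (V → ℝ)) := NormedAlgebra.restrictScalars ℚ ℝ _
        rw [← NormedSpace.exp_add_of_commute (Commute.refl A').neg_right]
        simp
      exact congrArg (fun L : (V → ℝ) →L[ℝ] (V → ℝ) => L x₁) h1

/-! ### Removing an isolated or a dominating vertex -/

namespace SimpleGraph

variable {V : Type*} [Fintype V] [DecidableEq V] (G : SimpleGraph V) [DecidableRel G.Adj]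

theorem neighborFinset_of_forall_adj {v : V} (hv : ∀ w, w ≠ v → G.Adj v w) :
    G.neighborFinset v = {v}ᶜ := by
  ext w
  simp only [mem_neighborFinset, Finset.mem_compl, Finset.mem_singleton]
  exact ⟨fun h => h.ne', hv w⟩

theorem degree_of_forall_adj {v : V} (hv : ∀ w, w ≠ v → G.Adj v w) :
    G.degree v = Fintype.card V - 1 := by
  rw [← card_neighborFinset_eq_degree, neighborFinset_of_forall_adj G hv, Finset.card_compl,
    Finset.card_singleton]

theorem sum_neighborFinset_induce_compl_singleton {M : Type*} [AddCommMonoid M] (v : V)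
    [DecidableRel (G.induce {v}ᶜ).Adj] (f : V → M) (w : ({v}ᶜ : Set V)) :
    ∑ a ∈ (G.induce {v}ᶜ).neighborFinset w, f a = ∑ a ∈ (G.neighborFinset w).erase v, f a := by
  refine Finset.sum_bij (fun a _ => (a : V)) ?_ ?_ ?_ ?_
  · rintro ⟨a, ha⟩ h
    simp only [mem_neighborFinset, comap_adj, Finset.mem_erase] at h ⊢
    exact ⟨ha, h⟩
  · rintro a _ b _ h
    exact Subtype.ext h
  · intro a ha
    rw [Finset.mem_erase, mem_neighborFinset] at ha
    exact ⟨⟨a, ha.1⟩, by simpa using ha.2, rfl⟩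
  · intros; rfl

theorem degree_induce_of_forall_not_adj {v : V} (hv : ∀ w, ¬ G.Adj v w)
    [DecidableRel (G.induce {v}ᶜ).Adj] (w : ({v}ᶜ : Set V)) :
    (G.induce {v}ᶜ).degree w = G.degree w := by
  have h := sum_neighborFinset_induce_compl_singleton G v (fun _ => 1) w
  rw [Finset.erase_eq_of_notMem (by simpa using fun h => hv w h.symm)] at h
  simpa using h

theorem degree_induce_add_one_of_forall_adj {v : V} (hv : ∀ w, w ≠ v → G.Adj v w)
    [DecidableRel (G.induce {v}ᶜ).Adj] (w : ({v}ᶜ : Set V)) :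
    (G.induce {v}ᶜ).degree w + 1 = G.degree w := by
  have h := sum_neighborFinset_induce_compl_singleton G v (fun _ => 1) w
  have hm : v ∈ G.neighborFinset w := by simpa using (hv w w.2).symm
  simp only [Finset.sum_const, smul_eq_mul, mul_one, card_neighborFinset_eq_degree] at h
  rw [h, Finset.card_erase_add_one hm, card_neighborFinset_eq_degree]

theorem lapMatrix_induce_of_forall_not_adj {v : V} (hv : ∀ w, ¬ G.Adj v w)
    [DecidableRel (G.induce {v}ᶜ).Adj] (x : V → ℝ) (w : ({v}ᶜ : Set V)) :
    ((G.induce {v}ᶜ).lapMatrix ℝ *ᵥ fun a => x a) w = (G.lapMatrix ℝ *ᵥ x) w := by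
  rw [lapMatrix_mulVec_apply, lapMatrix_mulVec_apply,
    degree_induce_of_forall_not_adj G hv, sum_neighborFinset_induce_compl_singleton G v x,
    Finset.erase_eq_of_notMem (by simpa using fun h => hv w h.symm)]

theorem lapMatrix_induce_of_forall_adj {v : V} (hv : ∀ w, w ≠ v → G.Adj v w)
    [DecidableRel (G.induce {v}ᶜ).Adj] (x : V → ℝ) (w : ({v}ᶜ : Set V)) :
    ((G.induce {v}ᶜ).lapMatrix ℝ *ᵥ fun a => x a) w =
      (G.lapMatrix ℝ *ᵥ x) w - x w + x v := by
  have hm : v ∈ G.neighborFinset w := by simpa using (hv w w.2).symm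
  rw [lapMatrix_mulVec_apply, lapMatrix_mulVec_apply,
    ← degree_induce_add_one_of_forall_adj G hv, sum_neighborFinset_induce_compl_singleton G v x,
    ← Finset.add_sum_erase _ _ hm]
  push_cast
  ring

theorem lapMatrix_mulVec_of_forall_not_adj {v : V} (hv : ∀ w, ¬ G.Adj v w) (x : V → ℝ) :
    (G.lapMatrix ℝ *ᵥ x) v = 0 := by
  rw [lapMatrix_mulVec_apply, (G.degree_eq_zero v).2 hv,
    Finset.sum_eq_zero fun a ha => absurd ((mem_neighborFinset G v a).1 ha) (hv a)]
  simp

theorem lapMatrix_mulVec_compl (x : V → ℝ) (v : V) :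
    (Gᶜ.lapMatrix ℝ *ᵥ x) v
      = Fintype.card V * x v - ∑ w, x w - (G.lapMatrix ℝ *ᵥ x) v := by
  have hdeg : (Gᶜ.degree v : ℝ) = Fintype.card V - 1 - G.degree v := by
    have h1 := G.degree_lt_card_verts v
    have h2 : Gᶜ.degree v + G.degree v + 1 = Fintype.card V := by rw [degree_compl]; omega
    rw [← h2]; push_cast; ring
  have hsum : ∑ w, x w = x v + ∑ w ∈ G.neighborFinset v, x w + ∑ w ∈ Gᶜ.neighborFinset v, x w := by
    have h1 : Gᶜ.neighborFinset v = (insert v (G.neighborFinset v))ᶜ := by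
      ext w
      simp only [mem_neighborFinset, compl_adj, Finset.mem_compl, Finset.mem_insert, not_or]
      exact and_congr_left fun _ => ne_comm
    rw [h1, ← Finset.sum_insert (by simp), Finset.sum_add_sum_compl]
  rw [lapMatrix_mulVec_apply, lapMatrix_mulVec_apply, hdeg, hsum]
  ring

/-- The column sums of the Laplacian vanish. -/
theorem sum_lapMatrix_mulVec (x : V → ℝ) : ∑ v, (G.lapMatrix ℝ *ᵥ x) v = 0 := by
  have h : (fun _ => 1 : V → ℝ) ⬝ᵥ (G.lapMatrix ℝ *ᵥ x) = 0 := by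
    rw [dotProduct_mulVec, ← mulVec_transpose, (G.isSymm_lapMatrix ℝ).eq,
      G.lapMatrix_mulVec_const_eq_zero, zero_dotProduct]
  simpa [dotProduct] using h

theorem lapMatrix_mulVec_single_sub_single_of_adj_iff {a b : V}
    (h : ∀ c, c ≠ a → c ≠ b → (G.Adj a c ↔ G.Adj b c)) (hab : a ≠ b)
    (hdeg : G.degree a = G.degree b) :
    G.lapMatrix ℝ *ᵥ (Pi.single a 1 - Pi.single b 1) =
      ((G.degree a : ℝ) + if G.Adj a b then 1 else 0) • (Pi.single a 1 - Pi.single b 1) := by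
  ext v
  rw [lapMatrix_mulVec_apply]
  simp only [Pi.sub_apply, Pi.single_apply, Finset.sum_sub_distrib, Finset.sum_ite_eq',
    mem_neighborFinset, Pi.smul_apply, smul_eq_mul]
  by_cases hva : v = a
  · subst hva
    simp [hab]
  by_cases hvb : v = b
  · subst hvb
    rw [hdeg]
    simp [hab.symm, G.adj_comm a v]
    ring
  · simp [hva, hvb, G.adj_comm v, h v hva hvb]

end SimpleGraph

/-! ### Threshold graphs -/

namespace IsThreshold

open SimpleGraph

theorem compl {V : Type u} {G : SimpleGraph V} (h : IsThreshold G) : IsThreshold Gᶜ := by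
  have hind : ∀ {V : Type u} (G : SimpleGraph V) (v : V),
      Gᶜ.induce {v}ᶜ = (G.induce {v}ᶜ)ᶜ := by
    intro V G v
    ext a b
    simp [Subtype.ext_iff]
  induction h with
  | single G => exact .single _
  | union G v hv _ ih =>
    refine .join _ v (fun w hw => ?_) ?_
    · rw [compl_adj]; exact ⟨hw.symm, hv w⟩
    · rwa [hind]
  | join G v hv _ ih =>
    refine .union _ v (fun w hw => ?_) ?_
    · rw [compl_adj] at hw; exact hw.2 (hv w hw.1.symm)
    · rwa [hind]

/-- Nodes of equal degree in a threshold graph are twins: a node sharing its degree with an isolated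
(dominating) node is itself isolated (dominating), and otherwise both survive the removal of the
last node. -/
theorem adj_iff_of_degree_eq {V : Type u} {G : SimpleGraph V} (h : IsThreshold G) :
    ∀ [Fintype V] [DecidableEq V] [DecidableRel G.Adj] (a b c : V), G.degree a = G.degree b →
      c ≠ a → c ≠ b → (G.Adj a c ↔ G.Adj b c) := by
  induction h with
  | single G => intro _ _ _ a b c _ hca; exact absurd (Subsingleton.elim c a) hca
  | @union V G v hv _ ih =>
    intro _ _ _ a b c hab hca hcb
    have hd0 := (G.degree_eq_zero v).2 hv
    have hz : ∀ w, G.degree w = 0 → ∀ c, ¬ G.Adj w c := fun w hw c hc =>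
      ((G.degree_pos_iff_exists_adj w).2 ⟨c, hc⟩).ne' hw
    by_cases hav : a = v
    · subst hav
      exact iff_of_false (hv c) (hz b (hab ▸ hd0) c)
    by_cases hbv : b = v
    · subst hbv
      exact iff_of_false (hz a (hab ▸ hd0) c) (hv c)
    by_cases hcv : c = v
    · subst hcv
      exact iff_of_false (fun h => hv a h.symm) (fun h => hv b h.symm)
    · have := @ih _ _ (Classical.decRel _) ⟨a, hav⟩ ⟨b, hbv⟩ ⟨c, hcv⟩ (by
        let _ : DecidableRel (G.induce {v}ᶜ).Adj := Classical.decRel _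
        have h1 := degree_induce_of_forall_not_adj G hv ⟨a, hav⟩
        have h2 := degree_induce_of_forall_not_adj G hv ⟨b, hbv⟩
        exact (h1.trans hab).trans h2.symm)
      exact this (fun h => hca (congrArg Subtype.val h)) (fun h => hcb (congrArg Subtype.val h))
  | @join V G v hv _ ih =>
    intro _ _ _ a b c hab hca hcb
    have hdom : ∀ w, G.degree w = Fintype.card V - 1 → ∀ c, c ≠ w → G.Adj w c := by
      intro w hw c hc
      have hsub : G.neighborFinset w ⊆ {w}ᶜ := fun x hx => by
        simpa using ((mem_neighborFinset G w x).1 hx).ne'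
      have heq := Finset.eq_of_subset_of_card_le hsub
        (by rw [card_neighborFinset_eq_degree, hw, Finset.card_compl, Finset.card_singleton])
      rw [← mem_neighborFinset, heq]
      simpa using hc
    have hd1 := degree_of_forall_adj G hv
    by_cases hav : a = v
    · subst hav
      exact iff_of_true (hv c hca) (hdom b (hab ▸ hd1) c hcb)
    by_cases hbv : b = v
    · subst hbv
      exact iff_of_true (hdom a (hab ▸ hd1) c hca) (hv c hcb)
    by_cases hcv : c = v
    · subst hcv
      exact iff_of_true (hv a hav).symm (hv b hbv).symm
    · have := @ih _ _ (Classical.decRel _) ⟨a, hav⟩ ⟨b, hbv⟩ ⟨c, hcv⟩ (by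
        let _ : DecidableRel (G.induce {v}ᶜ).Adj := Classical.decRel _
        have h1 := degree_induce_add_one_of_forall_adj G hv ⟨a, hav⟩
        have h2 := degree_induce_add_one_of_forall_adj G hv ⟨b, hbv⟩
        exact Nat.add_right_cancel ((h1.trans hab).trans h2.symm))
      exact this (fun h => hca (congrArg Subtype.val h)) (fun h => hcb (congrArg Subtype.val h))

/-- A vector that is constant along edges and supported on nodes of distinct degrees vanishes on
every node that is not isolated. -/
theorem eq_zero_of_forall_adj_eq {V : Type u} {G : SimpleGraph V} (h : IsThreshold G) :
    ∀ [Fintype V] [DecidableEq V] [DecidableRel G.Adj] (x : V → ℝ),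
      (∀ a b, G.Adj a b → x a = x b) → Set.InjOn (fun v => G.degree v) x.support →
      ∀ a b, G.Adj a b → x a = 0 := by
  induction h with
  | single G => intro _ _ _ x _ _ a b hab; exact absurd (Subsingleton.elim a b) hab.ne
  | @union V G v hv _ ih =>
    intro _ _ _ x hx hinj a b hab
    have hav : a ≠ v := fun h => hv b (h ▸ hab)
    have hbv : b ≠ v := fun h => hv a (h ▸ hab.symm)
    refine @ih _ _ (Classical.decRel _) (fun w => x w) (fun a b hab => hx a b hab) ?_
      ⟨a, hav⟩ ⟨b, hbv⟩ hab
    let _ : DecidableRel (G.induce {v}ᶜ).Adj := Classical.decRel _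
    intro c hc d hd hcd
    refine Subtype.ext (hinj hc hd ?_)
    have h1 := degree_induce_of_forall_not_adj G hv c
    have h2 := degree_induce_of_forall_not_adj G hv d
    exact (h1.symm.trans hcd).trans h2
  | @join V G v hv _ _ =>
    intro _ _ _ x hx hinj a b hab
    have hconst : ∀ w, x w = x v := fun w => by
      by_cases hw : w = v
      · rw [hw]
      · exact (hx v w (hv w hw)).symm
    -- All degrees lie in `[1, n - 1]`, so two of the `n` nodes have equal degree.
    have hcard : 1 < Fintype.card V := Fintype.one_lt_card_iff.2 ⟨a, b, hab.ne⟩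
    obtain ⟨c, -, d, -, hcd, hdeg⟩ := Finset.exists_ne_map_eq_of_card_lt_of_maps_to
      (s := (Finset.univ : Finset V)) (t := Finset.Icc 1 (Fintype.card V - 1))
      (f := fun w => G.degree w) (by simp; omega) (fun w _ => by
        have h1 := G.degree_lt_card_verts w
        have h2 : 0 < G.degree w := by
          rw [degree_pos_iff_exists_adj]
          by_cases hw : w = v
          · by_cases ha : a = v
            · exact ⟨b, hw ▸ ha ▸ hab⟩
            · exact ⟨a, hw ▸ hv a ha⟩
          · exact ⟨v, (hv w hw).symm⟩
        simp only [Finset.coe_Icc, Set.mem_Icc]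
        omega)
    by_contra hne
    have hv0 : x v ≠ 0 := hconst a ▸ hne
    exact hcd (hinj (by simpa [hconst c] using hv0) (by simpa [hconst d] using hv0) hdeg)

/-- The kernel case of `eq_zero_of_lapMatrix_mulVec_eq_smul`. -/
theorem eq_zero_of_lapMatrix_mulVec_eq_zero {V : Type u} {G : SimpleGraph V} (h : IsThreshold G)
    [Fintype V] [DecidableEq V] [DecidableRel G.Adj] {x : V → ℝ} (hx : G.lapMatrix ℝ *ᵥ x = 0)
    (hsum : ∑ v, x v = 0) (hinj : Set.InjOn (fun v => G.degree v) x.support) : x = 0 := by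
  rw [lapMatrix_mulVec_eq_zero_iff_forall_adj] at hx
  have hadj := h.eq_zero_of_forall_adj_eq x hx hinj
  have hd : ∀ a, x a ≠ 0 → G.degree a = 0 := fun a ha => by
    by_contra hd
    obtain ⟨b, hb⟩ := (G.degree_pos_iff_exists_adj a).1 (Nat.pos_of_ne_zero hd)
    exact ha (hadj a b hb)
  -- Only isolated nodes can carry a nonzero entry, hence at most one node does.
  by_contra hne
  obtain ⟨a, ha⟩ := Function.ne_iff.1 hne
  refine ha ?_
  rw [Pi.zero_apply, ← hsum, Finset.sum_eq_single a (fun b _ hba => ?_) (by simp)]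
  by_contra hb
  exact hba (hinj hb ha ((hd b hb).trans (hd a ha).symm))

/-- An eigenvector of the Laplacian of a threshold graph, orthogonal to the constants, cannot be
supported on nodes of distinct degrees. -/
theorem eq_zero_of_lapMatrix_mulVec_eq_smul {V : Type u} {G : SimpleGraph V}
    (h : IsThreshold G) :
    ∀ [Fintype V] [DecidableEq V] [DecidableRel G.Adj] (x : V → ℝ) (μ : ℝ),
      G.lapMatrix ℝ *ᵥ x = μ • x → ∑ v, x v = 0 →
      Set.InjOn (fun v => G.degree v) x.support → x = 0 := by
  have restrict : ∀ {V : Type u} [Fintype V] [DecidableEq V] (v : V) (x : V → ℝ), x v = 0 →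
      ∑ w, x w = 0 → ∑ w : ({v}ᶜ : Set V), x w = 0 := by
    intro V _ _ v x hxv hsum
    rw [← Finset.add_sum_erase _ _ (Finset.mem_univ v), hxv, zero_add] at hsum
    rw [← hsum]
    exact (Finset.sum_subtype _ (by simp) _).symm
  induction h with
  | single G =>
    intro _ _ _ x μ _ hsum _
    rw [Fintype.sum_unique] at hsum
    ext v
    rw [Subsingleton.elim v default, hsum]
    rfl
  | @union V G v hv hG ih =>
    intro _ _ _ x μ hx hsum hinj
    have h0 : μ * x v = 0 := by
      rw [← lapMatrix_mulVec_of_forall_not_adj G hv x, hx]; rfl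
    rcases mul_eq_zero.1 h0 with hμ | hxv
    · exact (IsThreshold.union G v hv hG).eq_zero_of_lapMatrix_mulVec_eq_zero
        (by rw [hx, hμ, zero_smul]) hsum hinj
    let _ : DecidableRel (G.induce {v}ᶜ).Adj := Classical.decRel _
    have hz := ih (fun w => x w) μ (funext fun w => by
        rw [lapMatrix_induce_of_forall_not_adj G hv x w, hx]; rfl) (restrict v x hxv hsum)
      (fun c hc d hd hcd => Subtype.ext (hinj hc hd (by
        simpa only [degree_induce_of_forall_not_adj G hv] using hcd)))
    ext w
    by_cases hw : w = v
    · rw [hw, hxv]; rfl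
    · exact congrFun hz ⟨w, hw⟩
  | @join V G v hv hG ih =>
    intro _ _ _ x μ hx hsum hinj
    -- On vectors orthogonal to the constants, `L(Gᶜ) = n - L(G)`, and `v` is isolated in `Gᶜ`.
    have hc : ∀ w, (Gᶜ.lapMatrix ℝ *ᵥ x) w = (Fintype.card V - μ) * x w := fun w => by
      rw [lapMatrix_mulVec_compl, hx, hsum, Pi.smul_apply, smul_eq_mul]; ring
    have h0 : (Fintype.card V - μ) * x v = 0 := by
      rw [← hc, lapMatrix_mulVec_of_forall_not_adj Gᶜ
        fun w hw => by rw [compl_adj] at hw; exact hw.2 (hv w hw.1.symm)]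
    rcases mul_eq_zero.1 h0 with hμ | hxv
    · refine (IsThreshold.join G v hv hG).compl.eq_zero_of_lapMatrix_mulVec_eq_zero
        (funext fun w => by rw [hc, hμ, zero_mul]; rfl) hsum fun a ha b hb hab => hinj ha hb ?_
      simp only [degree_compl] at hab ⊢
      have h1 := G.degree_lt_card_verts a
      have h2 := G.degree_lt_card_verts b
      omega
    let _ : DecidableRel (G.induce {v}ᶜ).Adj := Classical.decRel _
    have hz := ih (fun w => x w) (μ - 1) (funext fun w => by
        rw [lapMatrix_induce_of_forall_adj G hv x w, hx, hxv]
        simp only [Pi.smul_apply, smul_eq_mul]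
        ring) (restrict v x hxv hsum)
      (fun c hc d hd hcd => Subtype.ext (hinj hc hd (by
        simp only [← degree_induce_add_one_of_forall_adj G hv ⟨c, c.2⟩,
          ← degree_induce_add_one_of_forall_adj G hv ⟨d, d.2⟩]
        exact congrArg (· + 1) hcd)))
    ext w
    by_cases hw : w = v
    · rw [hw, hxv]; rfl
    · exact congrFun hz ⟨w, hw⟩

end IsThreshold

/-! ### Counting control nodes -/

theorem mem_controlNodes {V : Type*} [DecidableEq V] {m : ℕ} {j : Fin m → V} {v : V} :
    v ∈ controlNodes j ↔ ∃ k, j k = v := by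
  simp [controlNodes]

theorem vecMul_inputMatrix_eq_zero_iff {V : Type*} [Fintype V] [DecidableEq V] {m : ℕ}
    (j : Fin m → V) (q : V → ℝ) :
    q ᵥ* inputMatrix j = 0 ↔ ∀ v ∈ controlNodes j, q v = 0 := by
  have h : ∀ k, (q ᵥ* inputMatrix j) k = q (j k) := fun k => by
    simp [vecMul, dotProduct, inputMatrix]
  constructor
  · intro hq v hv
    obtain ⟨k, rfl⟩ := mem_controlNodes.1 hv
    rw [← h, hq, Pi.zero_apply]
  · intro hq
    ext k
    rw [h, hq _ (mem_controlNodes.2 ⟨k, rfl⟩), Pi.zero_apply]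

/-- The qualitative form of the result: a set of control nodes works exactly when the remaining
nodes have distinct degrees. -/
theorem laplacianControllable_iff_injOn_degree {V : Type*} [Fintype V] [DecidableEq V]
    (hn : 1 < Fintype.card V) {G : SimpleGraph V} [DecidableRel G.Adj] (hG : IsThreshold G)
    (hconn : G.Connected) {m : ℕ} (j : Fin m → V) :
    LaplacianControllable G j ↔
      Set.InjOn (fun v => G.degree v) ((controlNodes j)ᶜ : Finset V) := by
  rw [LaplacianControllable, isControllable_iff_of_isSymm (G.isSymm_lapMatrix ℝ).neg]
  simp only [vecMul_inputMatrix_eq_zero_iff]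
  constructor
  · intro h a ha b hb hdeg
    by_contra hab
    have hL := G.lapMatrix_mulVec_single_sub_single_of_adj_iff
      (fun c hca hcb => hG.adj_iff_of_degree_eq a b c hdeg hca hcb) hab hdeg
    have h0 := h (Pi.single a 1 - Pi.single b 1) _ (by rw [neg_mulVec, hL, ← neg_smul]) (by
      intro v hv
      have hva : v ≠ a := fun h => by simp [← h, hv] at ha
      have hvb : v ≠ b := fun h => by simp [← h, hv] at hb
      simp [hva, hvb])
    simpa [hab] using congrFun h0 a
  · intro h x μ hx hx0
    have hL : G.lapMatrix ℝ *ᵥ x = (-μ) • x := by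
      rw [neg_smul, ← hx, neg_mulVec, neg_neg]
    have hinj : Set.InjOn (fun v => G.degree v) x.support :=
      h.mono fun v hv => by
        rw [Finset.coe_compl, Set.mem_compl_iff]
        exact fun hc => hv (hx0 v hc)
    by_cases hμ : μ = 0
    · rw [hμ, neg_zero, zero_smul, G.lapMatrix_mulVec_eq_zero_iff_forall_adj] at hL
      have : Nontrivial V := Fintype.one_lt_card_iff_nontrivial.1 hn
      ext v
      obtain ⟨w, hw⟩ := hconn.preconnected.exists_adj_of_nontrivial v
      exact hG.eq_zero_of_forall_adj_eq x hL hinj v w hw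
    · refine hG.eq_zero_of_lapMatrix_mulVec_eq_smul x (-μ) hL ?_ hinj
      have hs := G.sum_lapMatrix_mulVec x
      simp only [hL, Pi.smul_apply, smul_eq_mul, ← Finset.mul_sum] at hs
      exact (mul_eq_zero.1 hs).resolve_left (neg_ne_zero.2 hμ)

/-- A function with fibres the cells of the partition is injective on the complement of `S` exactly
when `S` omits at most one element of each cell. -/
theorem Finpartition.injOn_compl_iff {α β : Type*} [Fintype α] [DecidableEq α]
    (P : Finpartition (Finset.univ : Finset α)) {f : α → β}
    (hf : ∀ a b, f a = f b ↔ ∃ C ∈ P.parts, a ∈ C ∧ b ∈ C) (S : Finset α) :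
    Set.InjOn f (Sᶜ : Finset α) ↔ ∀ C ∈ P.parts, (C \ S).card ≤ 1 := by
  constructor
  · intro h C hC
    refine Finset.card_le_one.2 fun a ha b hb => ?_
    rw [Finset.mem_sdiff] at ha hb
    exact h (by simpa using ha.2) (by simpa using hb.2) ((hf a b).2 ⟨C, hC, ha.1, hb.1⟩)
  · intro h a ha b hb hab
    obtain ⟨C, hC, haC, hbC⟩ := (hf a b).1 hab
    refine Finset.card_le_one.1 (h C hC) a ?_ b ?_
    · rw [Finset.mem_sdiff]; exact ⟨haC, by simpa using ha⟩
    · rw [Finset.mem_sdiff]; exact ⟨hbC, by simpa using hb⟩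

theorem Finpartition.sum_card_sdiff {α : Type*} [Fintype α] [DecidableEq α]
    (P : Finpartition (Finset.univ : Finset α)) (S : Finset α) :
    ∑ C ∈ P.parts, (C \ S).card = Fintype.card α - S.card := by
  rw [← Finset.card_compl, ← Finset.card_biUnion (t := fun C => C \ S) fun C hC D hD hCD =>
    Disjoint.mono Finset.sdiff_subset Finset.sdiff_subset (P.disjoint hC hD hCD)]
  congr 1
  ext a
  obtain ⟨C, hC, haC⟩ := P.exists_mem (Finset.mem_univ a)
  simp only [Finset.mem_biUnion, Finset.mem_sdiff, Finset.mem_compl]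
  exact ⟨fun ⟨_, _, h⟩ => h.2, fun h => ⟨C, hC, haC, h⟩⟩

theorem Finpartition.exists_card_sdiff_eq_one {α : Type*} [Fintype α] [DecidableEq α]
    (P : Finpartition (Finset.univ : Finset α)) :
    ∃ S : Finset α, ∀ C ∈ P.parts, (C \ S).card = 1 := by
  choose g hg using fun C : P.parts => P.nonempty_of_mem_parts C.2
  refine ⟨(Finset.univ.image g)ᶜ, fun C hC => Finset.card_eq_one.2 ⟨g ⟨C, hC⟩, ?_⟩⟩
  ext a
  simp only [Finset.mem_sdiff, Finset.mem_compl, Finset.mem_image, Finset.mem_univ, true_and,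
    not_not, Finset.mem_singleton]
  constructor
  · rintro ⟨haC, D, rfl⟩
    exact congrArg g (Subtype.ext (P.eq_of_mem_parts D.2 hC (hg D) haC))
  · rintro rfl
    exact ⟨hg ⟨C, hC⟩, _, rfl⟩

theorem mainTheorem5 {V : Type*} [Fintype V] [DecidableEq V] (hn : 1 < Fintype.card V)
    (G : SimpleGraph V) [DecidableRel G.Adj] (hG : IsThreshold G) (hconn : G.Connected) :
    IsLeast {c : ℕ | ∃ (m : ℕ) (j : Fin m → V),
        LaplacianControllable G j ∧ (controlNodes j).card = c}
      (Fintype.card V - (degreePartition G).parts.card) ∧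
    ∀ (m : ℕ) (j : Fin m → V),
      (controlNodes j).card = Fintype.card V - (degreePartition G).parts.card →
      (LaplacianControllable G j ↔
        ∀ C ∈ (degreePartition G).parts, (controlNodes j ∩ C).card = C.card - 1) := by
  set P := degreePartition G with hP
  have hiff : ∀ {m : ℕ} (j : Fin m → V), LaplacianControllable G j ↔
      ∀ C ∈ P.parts, (C \ controlNodes j).card ≤ 1 := fun j =>
    (laplacianControllable_iff_injOn_degree hn hG hconn j).trans
      (P.injOn_compl_iff (degree_eq_iff_exists_mem_degreePartition G) _)
  have hp : P.parts.card ≤ Fintype.card V := P.card_parts_le_card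
  refine ⟨⟨?_, ?_⟩, ?_⟩
  · -- Leave out exactly one node of each cell.
    obtain ⟨S, hS⟩ := P.exists_card_sdiff_eq_one
    let j : Fin S.card → V := fun k => S.equivFin.symm k
    have hj : controlNodes j = S := by
      ext v
      rw [mem_controlNodes]
      constructor
      · rintro ⟨k, rfl⟩
        exact (S.equivFin.symm k).2
      · intro hv
        exact ⟨S.equivFin ⟨v, hv⟩, by simp [j]⟩
    refine ⟨_, j, (hiff j).2 fun C hC => by rw [hj, hS C hC], ?_⟩
    have h1 := P.sum_card_sdiff S
    rw [Finset.sum_congr rfl hS, Finset.sum_const, smul_eq_mul, mul_one] at h1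
    have h2 := S.card_le_univ
    rw [hj]
    omega
  · rintro c ⟨m, j, hj, rfl⟩
    have h1 := P.sum_card_sdiff (controlNodes j)
    have h2 := Finset.sum_le_card_nsmul _ _ _ ((hiff j).1 hj)
    rw [smul_eq_mul, mul_one] at h2
    omega
  · intro m j hcard
    have hcell : ∀ C ∈ P.parts, ((controlNodes j ∩ C).card = C.card - 1 ↔
        (C \ controlNodes j).card = 1) := by
      intro C hC
      have h1 := Finset.card_sdiff_add_card_inter C (controlNodes j)
      have h2 := (P.nonempty_of_mem_parts hC).card_pos
      rw [Finset.inter_comm] at h1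
      omega
    rw [hiff, forall₂_congr hcell]
    refine ⟨fun h => ?_, fun h C hC => (h C hC).le⟩
    -- The numbers of omitted nodes are at most one and add up to the number of cells.
    refine (Finset.sum_eq_sum_iff_of_le h).1 ?_
    rw [P.sum_card_sdiff, hcard, Finset.sum_const, smul_eq_mul, mul_one]
    omega
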